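/- Let $\mathscr H$ be a complex separable Hilbert space. For $p>0$ let $\mathbb B_p(\mathscr H)$ be the Schatten class of compact operators $X$ on $\mathscr H$ with $\operatorname{tr}|X|^p<\infty$, where $|X|=(X^*X)^{1/2}$, and put $\|X\|_p=(\operatorname{tr}|X|^p)^{1/p}$. Let $1<p\le 2$ and $\frac1p+\frac1q=1$. Let $A_1,\dots,A_n\in\mathbb B_p(\mathscr H)$, and put $B=\sum_{k=1}^n A_k$ and $B_{i,j}=A_i-A_j$ for $1\le i<j\le n$. Let $Y$ and $Y_{i,j}$ ($1\le i<j\le n$) be operators in $\mathbb B_q(\mathscr H)$. Then $YB+\sum_{1\le i<j\le n}Y_{i,j}B_{i,j}$ is a trace class operator (that is, it lies in $\mathbb B_1(\mathscr H)$) and $$\Bigl|\operatorname{tr}\Bigl(YB+\sum_{1\le i<j\le n}Y_{i,j}B_{i,j}\Bigr)\Bigr|\le n^{1/q}\Bigl(\sum_{k=1}^n\|A_k\|_p^p\Bigr)^{1/p}\Bigl(\|Y\|_q^p+\sum_{1\le i<j\le n}\|Y_{i,j}\|_q^p\Bigr)^{1/p}.$$ -/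

import Mathlib

open scoped InnerProductSpace

noncomputable section

namespace Schatten

variable {H : Type*} [NormedAddCommGroup H] [InnerProductSpace ℂ H] [CompleteSpace H]

/-- The index set of a fixed orthonormal (Hilbert) basis of `H`. -/
def basisIndex (H : Type*) [NormedAddCommGroup H] [InnerProductSpace ℂ H] [CompleteSpace H] :
    Set H :=
  (exists_hilbertBasis ℂ H).choose

/-- A fixed orthonormal (Hilbert) basis of `H`. -/
def basis (H : Type*) [NormedAddCommGroup H] [InnerProductSpace ℂ H] [CompleteSpace H] :
    HilbertBasis (basisIndex H) ℂ H :=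
  (exists_hilbertBasis ℂ H).choose_spec.choose

/-- The trace `∑ ⟨e, T e⟩ ∈ [0, ∞]` of a positive bounded operator `T`, the sum being over an
orthonormal basis (the value is the same for all bases). -/
def posTrace (T : H →L[ℂ] H) : ENNReal :=
  ∑' e : basisIndex H, ENNReal.ofReal (⟪basis H e, T (basis H e)⟫_ℂ).re

/-- The usual trace `tr T = ∑ ⟨e, T e⟩` of a trace class operator `T`, the sum being over an
orthonormal basis. For trace class operators the sum converges absolutely and has the same
value for all bases. -/
def trace (T : H →L[ℂ] H) : ℂ :=
  ∑' e : basisIndex H, ⟪basis H e, T (basis H e)⟫_ℂ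

/-- `X` belongs to the Schatten class `𝔹_p(H)`: it is compact and `tr |X|^p < ∞`, where
`|X| = (X* X)^{1/2}` and powers of positive operators are given by functional calculus. -/
def Mem (p : ℝ) (X : H →L[ℂ] H) : Prop :=
  IsCompactOperator X ∧ posTrace (CFC.abs X ^ p) < ⊤

/-- The Schatten norm `‖X‖_p = (tr |X|^p)^{1/p}`, for `X` in the Schatten class `𝔹_p(H)`. -/
def norm (p : ℝ) (X : H →L[ℂ] H) : ℝ :=
  (posTrace (CFC.abs X ^ p)).toReal ^ (1 / p)

end Schatten

end

/-!
Write `Y_a` for `Y` and the `Y_{ij}`, and `∑ₖ ε_{ka} A_k` for `B` and the `B_{ij}`; the rows of `ε`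
are orthogonal with square norm `n`. For unit vectors `e_{ki}`, the Schmidt decompositions
`A_k = ∑ᵢ s_{ki} ⟨v_{ki}, ·⟩ f_{ki}` and `Y_a = ∑ⱼ t_{aj} ⟨g_{aj}, ·⟩ h_{aj}` turn
`∑ s_{ki} ⟨e_{ki}, ∑ₐ ε_{ka} Y_a f_{ki}⟩` into the bilinear form in `s` and `t` with matrix
`ε_{ka} ⟨g_{aj}, f_{ki}⟩ ⟨e_{ki}, h_{aj}⟩`.

By Bessel's inequality each row of this matrix has `ℓ¹` norm at most `1` on each block `a`, which is
the estimate at the endpoint `p = 1`. The entries are also the inner products of the orthonormal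
tensors `δ_a ⊗ g_{aj} ⊗ h̄_{aj}` with the orthogonal tensors `ε_k ⊗ f_{ki} ⊗ ē_{ki}`, which gives an
`ℓ²` bound with constant `√n`, the endpoint `p = 2`. The three lines theorem interpolates between
the two.

Choosing `e_{ki}` in the direction of `∑ₐ ε_{ka} Y_a f_{ki}` bounds the nuclear norm of a
representation of `∑ₐ Y_a ∑ₖ ε_{ka} A_k`, and with it both the trace class property and the trace.
-/

noncomputable section

namespace Schatten

universe u

open Filter Topology

open scoped TensorProduct

section Spectral

theorem hasSum_inner_smul_apply {𝕜 E F ι : Type*} [RCLike 𝕜] [NormedAddCommGroup E]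
    [InnerProductSpace 𝕜 E] [CompleteSpace E] [NormedAddCommGroup F] [NormedSpace 𝕜 F] {v : ι → E}
    (hv : Orthonormal 𝕜 v) {T : E →L[𝕜] F} (hT : ∀ y, (∀ i, inner 𝕜 (v i) y = 0) → T y = 0)
    (x : E) : HasSum (fun i => inner 𝕜 (v i) x • T (v i)) (T x) := by
  obtain ⟨w, b, hvw, hb⟩ := hv.toSubtypeRange.exists_hilbertBasis_extension
  have hsum : HasSum (fun e : w => inner 𝕜 (e : E) x • T e) (T x) := by
    simpa [hb, b.repr_apply_apply] using (b.hasSum_repr x).mapL T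
  let j : ι → w := fun i => ⟨v i, hvw ⟨i, rfl⟩⟩
  have hj : Function.Injective j := fun i i' h =>
    hv.linearIndependent.injective (congrArg Subtype.val h)
  refine (hj.hasSum_iff fun e he => ?_).2 hsum
  rw [hT e fun i => ?_, smul_zero]
  have horth := b.orthonormal.2 (i := j i) (j := e) fun h => he ⟨i, h⟩
  rwa [hb] at horth

variable {H : Type u} [NormedAddCommGroup H] [InnerProductSpace ℂ H] [CompleteSpace H]

theorem cfc_apply_eigenvector {T : H →L[ℂ] H} (hT : IsSelfAdjoint T) {f : ℝ → ℝ}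
    (hf : ContinuousOn f (spectrum ℝ T)) {μ : ℝ} {v : H} (h : T v = (μ : ℂ) • v) :
    cfc f T v = (f μ : ℂ) • v := by
  rcases eq_or_ne v 0 with rfl | hv
  · simp only [map_zero, smul_zero]
  have hμ : μ ∈ spectrum ℝ T := by
    refine spectrum.mem_iff.2 fun hu => hv ?_
    obtain ⟨S, hS⟩ := hu.exists_left_inv
    have hker : (algebraMap ℝ (H →L[ℂ] H) μ - T) v = 0 := by
      simp [Algebra.algebraMap_eq_smul_one, h]
    simpa [hker] using (congrArg (fun R : H →L[ℂ] H => R v) hS).symm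
  suffices key : ∀ g : C(spectrum ℝ T, ℝ), cfcHom hT g v = (g ⟨μ, hμ⟩ : ℂ) • v by
    rw [cfc_apply f T hT hf, key]
    rfl
  intro g
  induction g using ContinuousMap.induction_on_of_compact with
  | const r =>
    have hconst : ContinuousMap.const (spectrum ℝ T) r = algebraMap ℝ _ r := rfl
    rw [hconst, AlgHomClass.commutes]
    simp [Algebra.algebraMap_eq_smul_one]
  | id =>
    rw [cfcHom_id hT]
    simpa using h
  | star_id =>
    rw [map_star, cfcHom_id hT, hT.star_eq]
    simpa using h
  | add f g hf hg => simp [map_add, hf, hg, add_smul]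
  | mul f g hf hg =>
    rw [map_mul, mul_apply_eq_comp, hg, map_smul, hf, smul_smul, ContinuousMap.mul_apply,
      Complex.ofReal_mul, mul_comm]
  | frequently f hf =>
    have hclosed : IsClosed {g : C(spectrum ℝ T, ℝ) | cfcHom hT g v = (g ⟨μ, hμ⟩ : ℂ) • v} :=
      isClosed_eq ((ContinuousLinearMap.apply ℂ H v).continuous.comp (cfcHom_continuous hT))
        ((Complex.continuous_ofReal.comp (continuous_eval_const _)).smul continuous_const)
    exact hclosed.mem_of_frequently_of_tendsto hf tendsto_id

theorem exists_hilbertBasis_eigenvectors {T : H →L[ℂ] H} (hT : IsCompactOperator T)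
    (hT' : T.IsSymmetric) :
    ∃ (ι : Type u) (b : HilbertBasis ι ℂ H) (μ : ι → ℂ), ∀ i, T (b i) = μ i • b i := by
  let E (μ : ℂ) : Submodule ℂ H := Module.End.eigenspace (T : Module.End ℂ H) μ
  have hcomplete (μ : ℂ) : CompleteSpace (E μ) := by
    have hE : (E μ : Set H) = {x | T x = μ • x} := by
      ext x
      simp [E]
    have hclosed : IsClosed (E μ : Set H) := by
      rw [hE]
      exact isClosed_eq T.continuous (continuous_const_smul μ)
    exact hclosed.completeSpace_coe
  choose w b _ using fun μ => exists_hilbertBasis ℂ (E μ)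
  have horth := hT'.orthogonalFamily_eigenspaces.orthonormal_sigma_orthonormal
    (v_family := fun μ => b μ) fun μ => (b μ).orthonormal
  have hdense (μ : ℂ) {x : H} (hx : ∀ i, ⟪x, (b μ i : H)⟫_ℂ = 0) {y : H} (hy : y ∈ E μ) :
      ⟪x, y⟫_ℂ = 0 := by
    have hsum := (((b μ).hasSum_repr ⟨y, hy⟩).mapL (Submodule.subtypeL _)).mapL (innerSL ℂ x)
    exact hsum.unique (by simp [hx])
  refine ⟨Σ μ : ℂ, w μ, HilbertBasis.mkOfOrthogonalEqBot horth ?_, fun a => a.1, fun i => ?_⟩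
  · rw [eq_bot_iff, ← T.orthogonalComplement_iSup_eigenspaces_eq_bot hT hT']
    intro x hx
    rw [← Submodule.iInf_orthogonal, Submodule.mem_iInf]
    refine fun μ => (Submodule.mem_orthogonal' _ _).2 fun y hy => hdense μ (fun i => ?_) hy
    exact (Submodule.mem_orthogonal' _ _).1 hx _ (Submodule.subset_span ⟨⟨μ, i⟩, rfl⟩)
  · rw [HilbertBasis.coe_mkOfOrthogonalEqBot]
    exact Module.End.mem_eigenspace_iff.1 (b i.1 i.2).2

theorem posTrace_eq_tsum {ι : Type*} {v : ι → H} (hv : Orthonormal ℂ v) {T : H →L[ℂ] H}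
    (hT : ∀ y, (∀ i, ⟪v i, y⟫_ℂ = 0) → T y = 0) {μ : ι → ℝ} (hμ : ∀ i, 0 ≤ μ i)
    (h : ∀ i, T (v i) = (μ i : ℂ) • v i) : posTrace T = ∑' i, ENNReal.ofReal (μ i) := by
  have hquad (x : H) : HasSum (fun i => μ i * ‖⟪x, v i⟫_ℂ‖ ^ 2) (⟪x, T x⟫_ℂ).re := by
    have hsum := Complex.hasSum_re ((hasSum_inner_smul_apply hv hT x).mapL (innerSL ℂ x))
    convert! hsum using 2 with i
    rw [h, map_smul, map_smul, innerSL_apply_apply, smul_eq_mul, smul_eq_mul, mul_left_comm,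
      Complex.re_ofReal_mul, ← inner_conj_symm (v i), Complex.conj_mul', ← Complex.ofReal_pow,
      Complex.ofReal_re]
  have hparseval (i : ι) : ∑' e, ENNReal.ofReal (‖⟪basis H e, v i⟫_ℂ‖ ^ 2) = 1 := by
    have hsum : HasSum (fun e => ‖⟪basis H e, v i⟫_ℂ‖ ^ 2) 1 := by
      have hre := Complex.hasSum_re ((basis H).hasSum_inner_mul_inner (v i) (v i))
      rw [inner_self_eq_norm_sq_to_K, hv.1] at hre
      convert! hre using 2 with e
      · rw [← inner_conj_symm (v i), Complex.conj_mul', ← Complex.ofReal_pow, Complex.ofReal_re]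
      · simp
    rw [← ENNReal.ofReal_tsum_of_nonneg (fun e => sq_nonneg _) hsum.summable, hsum.tsum_eq,
      ENNReal.ofReal_one]
  calc posTrace T
      = ∑' (e) (i), ENNReal.ofReal (μ i) * ENNReal.ofReal (‖⟪basis H e, v i⟫_ℂ‖ ^ 2) := by
        refine tsum_congr fun e => ?_
        rw [← (hquad _).tsum_eq, ENNReal.ofReal_tsum_of_nonneg
          (fun i => mul_nonneg (hμ i) (sq_nonneg _)) (hquad _).summable]
        simp_rw [ENNReal.ofReal_mul (hμ _)]
    _ = ∑' i, ENNReal.ofReal (μ i) := by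
        rw [ENNReal.tsum_comm]
        simp_rw [ENNReal.tsum_mul_left, hparseval, mul_one]

theorem abs_rpow (X : H →L[ℂ] H) {p : ℝ} (hp : 0 < p) :
    CFC.abs X ^ p = cfc (fun x : ℝ => x ^ (p / 2)) (star X * X) := by
  have h0 : 0 ≤ star X * X := star_mul_self_nonneg X
  rw [CFC.abs, CFC.sqrt_eq_rpow, CFC.rpow_rpow_of_exponent_nonneg _ _ _ (by norm_num) hp.le,
    CFC.rpow_eq_cfc_real, one_div_mul_eq_div]

theorem abs_rpow_apply {X : H →L[ℂ] H} {p s : ℝ} (hp : 0 < p) (hs : 0 ≤ s) {v : H}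
    (hv : (star X * X) v = ((s ^ 2 : ℝ) : ℂ) • v) :
    (CFC.abs X ^ p) v = ((s ^ p : ℝ) : ℂ) • v := by
  have hcont : Continuous fun x : ℝ => x ^ (p / 2) := Real.continuous_rpow_const (by positivity)
  rw [abs_rpow X hp, cfc_apply_eigenvector (IsSelfAdjoint.star_mul_self X) hcont.continuousOn hv,
    ← Real.rpow_natCast, ← Real.rpow_mul hs, Nat.cast_ofNat, mul_div_cancel₀ p two_ne_zero]

end Spectral

/-- A Schmidt (singular value) decomposition `X x = ∑ᵢ sᵢ ⟨vᵢ, x⟩ fᵢ` of an operator `X`. Only the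
nonzero singular values are listed, so the kernel of `X` is the orthogonal complement of the
`vᵢ`. -/
structure SchmidtDecomposition {H : Type u} [NormedAddCommGroup H] [InnerProductSpace ℂ H]
    (X : H →L[ℂ] H) where
  ι : Type u
  s : ι → ℝ
  v : ι → H
  f : ι → H
  s_pos : ∀ i, 0 < s i
  v_orthonormal : Orthonormal ℂ v
  f_orthonormal : Orthonormal ℂ f
  hasSum : ∀ x, HasSum (fun i => ((s i : ℂ) * ⟪v i, x⟫_ℂ) • f i) (X x)

namespace SchmidtDecomposition

section

variable {H : Type u} [NormedAddCommGroup H] [InnerProductSpace ℂ H] {X : H →L[ℂ] H}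

theorem apply_v (S : SchmidtDecomposition X) (i : S.ι) : X (S.v i) = (S.s i : ℂ) • S.f i := by
  classical
  refine (S.hasSum (S.v i)).unique ?_
  have hterm (j : S.ι) : ((S.s j : ℂ) * ⟪S.v j, S.v i⟫_ℂ) • S.f j =
      if j = i then (S.s i : ℂ) • S.f i else 0 := by
    rw [orthonormal_iff_ite.1 S.v_orthonormal j i]
    split_ifs with hj <;> simp [hj]
  simp_rw [hterm]
  exact hasSum_ite_eq i _

theorem inner_f_apply (S : SchmidtDecomposition X) (i : S.ι) (x : H) :
    ⟪S.f i, X x⟫_ℂ = S.s i * ⟪S.v i, x⟫_ℂ := by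
  classical
  refine ((S.hasSum x).mapL (innerSL ℂ (S.f i))).unique ?_
  have hterm (j : S.ι) : innerSL ℂ (S.f i) (((S.s j : ℂ) * ⟪S.v j, x⟫_ℂ) • S.f j) =
      if j = i then (S.s i : ℂ) * ⟪S.v i, x⟫_ℂ else 0 := by
    rw [map_smul, innerSL_apply_apply, orthonormal_iff_ite.1 S.f_orthonormal i j, smul_eq_mul]
    split_ifs with h h' <;> simp_all
  simp_rw [hterm]
  exact hasSum_ite_eq i _

theorem norm_v_mul_norm_smul (S : SchmidtDecomposition X) (i : S.ι) (y : H) :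
    ‖S.v i‖ * ‖(S.s i : ℂ) • y‖ = S.s i * ‖y‖ := by
  rw [S.v_orthonormal.1, one_mul, norm_smul, Complex.norm_real,
    Real.norm_of_nonneg (S.s_pos i).le]

end

variable {H : Type u} [NormedAddCommGroup H] [InnerProductSpace ℂ H] [CompleteSpace H]
  {X : H →L[ℂ] H}

theorem star_mul_self_apply_v (S : SchmidtDecomposition X) (i : S.ι) :
    (star X * X) (S.v i) = ((S.s i ^ 2 : ℝ) : ℂ) • S.v i := by
  refine ext_inner_left ℂ fun y => ?_
  rw [mul_apply_eq_comp, ContinuousLinearMap.star_eq_adjoint,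
    ContinuousLinearMap.adjoint_inner_right, S.apply_v, inner_smul_right, inner_smul_right,
    ← inner_conj_symm, S.inner_f_apply, map_mul, Complex.conj_ofReal, inner_conj_symm,
    Complex.ofReal_pow, sq, mul_assoc]

theorem posTrace_abs_rpow (S : SchmidtDecomposition X) {p : ℝ} (hp : 0 < p) :
    posTrace (CFC.abs X ^ p) = ∑' i, ENNReal.ofReal (S.s i ^ p) := by
  refine posTrace_eq_tsum S.v_orthonormal (fun y hy => ?_)
    (fun i => Real.rpow_nonneg (S.s_pos i).le p)
    fun i => abs_rpow_apply hp (S.s_pos i).le (S.star_mul_self_apply_v i)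
  have hXy : X y = 0 := (S.hasSum y).unique (by simp [hy])
  have hker : (star X * X) y = (((0 : ℝ) ^ 2 : ℝ) : ℂ) • y := by simp [hXy]
  rw [abs_rpow_apply hp le_rfl hker, Real.zero_rpow hp.ne', Complex.ofReal_zero, zero_smul]

theorem summable_rpow (S : SchmidtDecomposition X) {p : ℝ} (hp : 0 < p) (hX : Mem p X) :
    Summable fun i => S.s i ^ p := by
  have hfin := hX.2
  rw [S.posTrace_abs_rpow hp] at hfin
  exact (ENNReal.summable_toReal hfin.ne).congr fun i =>
    ENNReal.toReal_ofReal (Real.rpow_nonneg (S.s_pos i).le p)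

theorem norm_rpow (S : SchmidtDecomposition X) {p : ℝ} (hp : 0 < p) (hX : Mem p X) :
    norm p X ^ p = ∑' i, S.s i ^ p := by
  have hs (i : S.ι) : 0 ≤ S.s i ^ p := Real.rpow_nonneg (S.s_pos i).le p
  rw [norm, S.posTrace_abs_rpow hp, ← ENNReal.ofReal_tsum_of_nonneg hs (S.summable_rpow hp hX),
    ENNReal.toReal_ofReal (tsum_nonneg hs), ← Real.rpow_mul (tsum_nonneg hs),
    one_div_mul_cancel hp.ne', Real.rpow_one]

theorem sum_rpow_le (S : SchmidtDecomposition X) {p : ℝ} (hp : 0 < p) (hX : Mem p X)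
    (J : Finset S.ι) : ∑ i ∈ J, S.s i ^ p ≤ norm p X ^ p := by
  rw [S.norm_rpow hp hX]
  exact (S.summable_rpow hp hX).sum_le_tsum J fun i _ => Real.rpow_nonneg (S.s_pos i).le p

theorem nonempty (hX : IsCompactOperator X) : Nonempty (SchmidtDecomposition X) := by
  obtain ⟨ι, b, μ, hb⟩ := exists_hilbertBasis_eigenvectors (hX.clm_comp (star X))
    (IsSelfAdjoint.star_mul_self X).isSymmetric
  have hinner (i j : ι) : ⟪X (b i), X (b j)⟫_ℂ = μ j * ⟪b i, b j⟫_ℂ := by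
    rw [← ContinuousLinearMap.adjoint_inner_right, ← ContinuousLinearMap.star_eq_adjoint,
      ← inner_smul_right, ← hb]
    rfl
  let κ := {i // X (b i) ≠ 0}
  have hne (i : κ) : (‖X (b i)‖ : ℂ) ≠ 0 := Complex.ofReal_ne_zero.2 (norm_ne_zero_iff.2 i.2)
  refine ⟨{
    ι := κ
    s := fun i => ‖X (b i)‖
    v := fun i => b i
    f := fun i => (‖X (b i)‖ : ℂ)⁻¹ • X (b i)
    s_pos := fun i => norm_pos_iff.2 i.2
    v_orthonormal := b.orthonormal.comp _ Subtype.val_injective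
    f_orthonormal := ⟨fun i => ?_, fun i j hij => ?_⟩
    hasSum := fun x => ?_ }⟩
  · rw [norm_smul, norm_inv, Complex.norm_real, norm_norm]
    exact inv_mul_cancel₀ (norm_ne_zero_iff.2 i.2)
  · dsimp only
    rw [inner_smul_left, inner_smul_right, hinner,
      b.orthonormal.2 fun h => hij (Subtype.ext h), mul_zero, mul_zero, mul_zero]
  · have hsum := (b.hasSum_repr x).mapL X
    have hsupp : Function.support (fun i => X (b.repr x i • b i)) ⊆ {i | X (b i) ≠ 0} :=
      fun i hi h0 => hi ((map_smul X _ _).trans (by rw [h0, smul_zero]))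
    refine ((hasSum_subtype_iff_of_support_subset hsupp).2 hsum).congr_fun fun i : κ => ?_
    rw [smul_smul, mul_right_comm, mul_inv_cancel₀ (hne i), one_mul, Function.comp_apply, map_smul,
      b.repr_apply_apply]

end SchmidtDecomposition

protected theorem norm_nonneg {H : Type*} [NormedAddCommGroup H] [InnerProductSpace ℂ H]
    [CompleteSpace H] (p : ℝ) (X : H →L[ℂ] H) : 0 ≤ norm p X :=
  Real.rpow_nonneg ENNReal.toReal_nonneg _

theorem sum_norm_inner_mul_le {𝕜 E E' κ : Type*} [RCLike 𝕜] [NormedAddCommGroup E]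
    [InnerProductSpace 𝕜 E] [NormedAddCommGroup E'] [InnerProductSpace 𝕜 E'] {w : κ → E}
    {x : κ → E'} (hw : Orthonormal 𝕜 w) (hx : Orthonormal 𝕜 x) (F : Finset κ) (a : E) (b : E') :
    ∑ i ∈ F, ‖inner 𝕜 (w i) a‖ * ‖inner 𝕜 b (x i)‖ ≤ ‖a‖ * ‖b‖ := by
  refine (Real.sum_mul_le_sqrt_mul_sqrt _ _ _).trans ?_
  simp_rw [norm_inner_symm b]
  gcongr
  · exact Real.sqrt_le_iff.2 ⟨norm_nonneg _, hw.sum_inner_products_le a⟩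
  · exact Real.sqrt_le_iff.2 ⟨norm_nonneg _, hx.sum_inner_products_le b⟩

/-- A representation `T x = ∑ᵢ ⟨aᵢ, x⟩ bᵢ` with `∑ᵢ ‖aᵢ‖ ‖bᵢ‖ < ∞`, exhibiting `T` as a nuclear,
i.e. trace class, operator. -/
structure IsNuclearRep {H ι : Type*} [NormedAddCommGroup H] [InnerProductSpace ℂ H]
    (T : H →L[ℂ] H) (a b : ι → H) : Prop where
  summable : Summable fun i => ‖a i‖ * ‖b i‖
  hasSum : ∀ x, HasSum (fun i => ⟪a i, x⟫_ℂ • b i) (T x)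

namespace IsNuclearRep

theorem sum_norm_inner_le {H ι κ : Type*} [NormedAddCommGroup H] [InnerProductSpace ℂ H]
    {T : H →L[ℂ] H} {a b : ι → H} (h : IsNuclearRep T a b) {w x : κ → H} (hw : Orthonormal ℂ w)
    (hx : Orthonormal ℂ x) (F : Finset κ) :
    ∑ k ∈ F, ‖⟪w k, T (x k)⟫_ℂ‖ ≤ ∑' i, ‖a i‖ * ‖b i‖ := by
  have hinner (k : κ) : HasSum (fun i => ⟪a i, x k⟫_ℂ * ⟪w k, b i⟫_ℂ) ⟪w k, T (x k)⟫_ℂ := by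
    simpa [inner_smul_right] using (h.hasSum (x k)).mapL (innerSL ℂ (w k))
  have hsummable (k : κ) : Summable fun i => ‖⟪w k, b i⟫_ℂ‖ * ‖⟪a i, x k⟫_ℂ‖ := by
    refine h.summable.of_nonneg_of_le (fun i => by positivity) fun i => ?_
    simpa [mul_comm] using sum_norm_inner_mul_le hw hx {k} (b i) (a i)
  calc ∑ k ∈ F, ‖⟪w k, T (x k)⟫_ℂ‖
      ≤ ∑ k ∈ F, ∑' i, ‖⟪w k, b i⟫_ℂ‖ * ‖⟪a i, x k⟫_ℂ‖ := by
        refine Finset.sum_le_sum fun k _ => ?_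
        rw [← (hinner k).tsum_eq]
        simp_rw [mul_comm ‖⟪w k, _⟫_ℂ‖, ← norm_mul]
        exact norm_tsum_le_tsum_norm ((hsummable k).congr fun i => by rw [norm_mul, mul_comm])
    _ = ∑' i, ∑ k ∈ F, ‖⟪w k, b i⟫_ℂ‖ * ‖⟪a i, x k⟫_ℂ‖ :=
        (Summable.tsum_finsetSum fun k _ => hsummable k).symm
    _ ≤ ∑' i, ‖a i‖ * ‖b i‖ :=
        Summable.tsum_le_tsum
          (fun i => (sum_norm_inner_mul_le hw hx F _ _).trans_eq (mul_comm _ _))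
          (summable_sum fun k _ => hsummable k) h.summable

variable {H ι : Type*} [NormedAddCommGroup H] [InnerProductSpace ℂ H] [CompleteSpace H]
  {T : H →L[ℂ] H} {a b : ι → H}

theorem isCompactOperator (h : IsNuclearRep T a b) : IsCompactOperator T := by
  let R (i : ι) : H →L[ℂ] H := InnerProductSpace.rankOne ℂ (b i) (a i)
  have hsummable : Summable R := by
    refine Summable.of_norm (h.summable.congr fun i => ?_)
    rw [InnerProductSpace.norm_rankOne, mul_comm]
  have hT : HasSum R T := by
    convert! hsummable.hasSum using 1
    refine ContinuousLinearMap.ext fun x => (h.hasSum x).unique ?_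
    simpa [R] using hsummable.hasSum.mapL (ContinuousLinearMap.apply ℂ H x)
  refine isCompactOperator_of_tendsto hT (Eventually.of_forall fun F => ?_)
  refine (compactOperator (RingHom.id ℂ) H H).sum_mem fun i _ => ?_
  exact (isCompactOperator_of_locallyCompactSpace_dom (innerSL ℂ (a i))).clm_comp
    (ContinuousLinearMap.toSpanSingleton ℂ (b i))

theorem mem_one (h : IsNuclearRep T a b) : Mem 1 T := by
  obtain ⟨S⟩ := SchmidtDecomposition.nonempty h.isCompactOperator
  have hs (i : S.ι) : 0 ≤ S.s i := (S.s_pos i).le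
  have hterm (i : S.ι) : S.s i = ‖⟪S.f i, T (S.v i)⟫_ℂ‖ := by
    rw [S.inner_f_apply, inner_self_eq_norm_sq_to_K, S.v_orthonormal.1]
    simp [abs_of_nonneg (hs i)]
  have hsummable : Summable S.s := summable_of_sum_le hs fun F =>
    (Finset.sum_congr rfl fun i _ => hterm i).trans_le
      (h.sum_norm_inner_le S.f_orthonormal S.v_orthonormal F)
  refine ⟨h.isCompactOperator, ?_⟩
  rw [S.posTrace_abs_rpow one_pos]
  simp_rw [Real.rpow_one]
  rw [← ENNReal.ofReal_tsum_of_nonneg hs hsummable]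
  exact ENNReal.ofReal_lt_top

theorem hasSum_trace (h : IsNuclearRep T a b) : HasSum (fun i => ⟪a i, b i⟫_ℂ) (trace T) := by
  let φ (x : ι × basisIndex H) : ℂ := ⟪a x.1, basis H x.2⟫_ℂ * ⟪basis H x.2, b x.1⟫_ℂ
  have hbessel (i : ι) (F : Finset (basisIndex H)) : ∑ e ∈ F, ‖φ (i, e)‖ ≤ ‖a i‖ * ‖b i‖ := by
    simpa only [φ, norm_mul, mul_comm] using
      sum_norm_inner_mul_le (basis H).orthonormal (basis H).orthonormal F (b i) (a i)
  have hfib (i : ι) : Summable fun e => ‖φ (i, e)‖ :=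
    summable_of_sum_le (fun e => norm_nonneg _) (hbessel i)
  have hφ : Summable φ := by
    refine Summable.of_norm ((summable_prod_of_nonneg fun _ => norm_nonneg _).2 ⟨hfib, ?_⟩)
    exact h.summable.of_nonneg_of_le (fun i => tsum_nonneg fun e => norm_nonneg _) fun i =>
      (hfib i).tsum_le_of_sum_le (hbessel i)
  have htrace : trace T = ∑' x, φ x := by
    rw [← (Equiv.prodComm _ _).tsum_eq φ]
    have hφ' := (Equiv.prodComm (basisIndex H) ι).summable_iff.2 hφ
    refine (hφ'.hasSum.prod_fiberwise fun e => ?_).tsum_eq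
    simpa [inner_smul_right, φ] using (h.hasSum (basis H e)).mapL (innerSL ℂ (basis H e))
  rw [htrace]
  exact hφ.hasSum.prod_fiberwise fun i => (basis H).hasSum_inner_mul_inner (a i) (b i)

theorem norm_trace_le (h : IsNuclearRep T a b) : ‖trace T‖ ≤ ∑' i, ‖a i‖ * ‖b i‖ := by
  rw [← h.hasSum_trace.tsum_eq]
  exact tsum_of_norm_bounded h.summable.hasSum fun i => norm_inner_le_norm _ _

end IsNuclearRep

theorem norm_le_interp_of_norm_le_re {f : ℂ → ℂ} (hf : Differentiable ℂ f) {B : ℝ → ℝ}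
    (hB : Continuous B) (hfB : ∀ z, ‖f z‖ ≤ B z.re) {a b : ℝ} (ha : ∀ z, z.re = 0 → ‖f z‖ ≤ a)
    (hb : ∀ z, z.re = 1 → ‖f z‖ ≤ b) {θ : ℝ} (hθ₀ : 0 ≤ θ) (hθ₁ : θ ≤ 1) :
    ‖f θ‖ ≤ a ^ (1 - θ) * b ^ θ := by
  obtain ⟨C, hC⟩ := isCompact_Icc.bddAbove_image (hB.continuousOn (s := Set.Icc 0 1))
  have hbdd : BddAbove ((Norm.norm ∘ f) '' Complex.HadamardThreeLines.verticalClosedStrip 0 1) :=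
    ⟨C, by rintro _ ⟨z, hz, rfl⟩; exact (hfB z).trans (hC ⟨z.re, hz, rfl⟩)⟩
  simpa using Complex.HadamardThreeLines.norm_le_interp_of_mem_verticalClosedStrip₀₁' f
    (z := (θ : ℂ)) (by exact ⟨hθ₀, hθ₁⟩) hf.diffContOnCl hbdd ha hb

theorem sum_sigma_le {I : Type*} [Fintype I] {l : I → Type*} {φ : (Σ a, l a) → ℝ} {M : I → ℝ}
    (h : ∀ a (J : Finset (l a)), ∑ j ∈ J, φ ⟨a, j⟩ ≤ M a) (G : Finset (Σ a, l a)) :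
    ∑ y ∈ G, φ y ≤ ∑ a, M a := by
  classical
  rw [← G.sigma_preimage_mk_of_subset (Finset.subset_univ _), Finset.sum_sigma]
  exact Finset.sum_le_sum fun a _ => h a _

/-- The bilinear form with matrix `c` restricted to finitely many rows and columns, the object that
is interpolated between its `ℓ¹` and `ℓ²` bounds. -/
def bilinearSum {α β : Type*} (c : α → β → ℂ) (F : Finset α) (G : Finset β) (u : α → ℂ)
    (w : β → ℂ) : ℂ :=
  ∑ x ∈ F, ∑ y ∈ G, c x y * (u x * w y)

theorem norm_bilinearSum_le {α β : Type*} (c : α → β → ℂ) (F : Finset α) (G : Finset β)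
    (u : α → ℂ) (w : β → ℂ) :
    ‖bilinearSum c F G u w‖ ≤ ∑ x ∈ F, ∑ y ∈ G, ‖c x y‖ * (‖u x‖ * ‖w y‖) := by
  refine norm_sum_le_of_le _ fun x _ => norm_sum_le_of_le _ fun y _ => ?_
  rw [norm_mul, norm_mul]

theorem norm_bilinearSum_le_interp {α β : Type*} {c : α → β → ℂ} {F : Finset α} {G : Finset β}
    {U : ℂ → α → ℂ} {W : ℂ → β → ℂ} (hU : ∀ x, Differentiable ℂ fun z => U z x)
    (hW : ∀ y, Differentiable ℂ fun z => W z y) (hU_re : ∀ z x, ‖U z x‖ = ‖U z.re x‖)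
    (hW_re : ∀ z y, ‖W z y‖ = ‖W z.re y‖) {a b : ℝ}
    (ha : ∀ z, z.re = 0 → ‖bilinearSum c F G (U z) (W z)‖ ≤ a)
    (hb : ∀ z, z.re = 1 → ‖bilinearSum c F G (U z) (W z)‖ ≤ b) {θ : ℝ} (hθ₀ : 0 ≤ θ)
    (hθ₁ : θ ≤ 1) : ‖bilinearSum c F G (U θ) (W θ)‖ ≤ a ^ (1 - θ) * b ^ θ := by
  have hdiff : Differentiable ℂ fun z => bilinearSum c F G (U z) (W z) := by
    unfold bilinearSum
    fun_prop
  have hcont : Continuous fun r : ℝ => ∑ x ∈ F, ∑ y ∈ G, ‖c x y‖ * (‖U r x‖ * ‖W r y‖) := by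
    have hU' (x : α) := (hU x).continuous
    have hW' (y : β) := (hW y).continuous
    fun_prop
  refine norm_le_interp_of_norm_le_re hdiff hcont (fun z => ?_) ha hb hθ₀ hθ₁
  simp_rw [← hU_re, ← hW_re]
  exact norm_bilinearSum_le c F G (U z) (W z)

section Interpolation

variable {α I : Type*} [Fintype I] {l : I → Type*} {c : α → (Σ a, l a) → ℂ} {F : Finset α}
  {G : Finset (Σ a, l a)}

theorem norm_bilinearSum_le_of_block (hc : ∀ x a (J : Finset (l a)), ∑ j ∈ J, ‖c x ⟨a, j⟩‖ ≤ 1)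
    (u : α → ℂ) {w : (Σ a, l a) → ℂ} {M : I → ℝ} (hM : ∀ a, 0 ≤ M a) (hw : ∀ y, ‖w y‖ ≤ M y.1) :
    ‖bilinearSum c F G u w‖ ≤ (∑ x ∈ F, ‖u x‖) * ∑ a, M a := by
  have hrow (x : α) : ∑ y ∈ G, ‖c x y‖ * ‖w y‖ ≤ ∑ a, M a :=
    sum_sigma_le (fun a J => calc
      ∑ j ∈ J, ‖c x ⟨a, j⟩‖ * ‖w ⟨a, j⟩‖ ≤ ∑ j ∈ J, ‖c x ⟨a, j⟩‖ * M a := by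
        gcongr with j
        exact hw ⟨a, j⟩
      _ = (∑ j ∈ J, ‖c x ⟨a, j⟩‖) * M a := (Finset.sum_mul _ _ _).symm
      _ ≤ M a := mul_le_of_le_one_left (hM a) (hc x a J)) G
  calc ‖bilinearSum c F G u w‖ ≤ ∑ x ∈ F, ‖u x‖ * ∑ y ∈ G, ‖c x y‖ * ‖w y‖ := by
        refine (norm_bilinearSum_le c F G u w).trans_eq ?_
        simp_rw [Finset.mul_sum, mul_left_comm]
    _ ≤ ∑ x ∈ F, ‖u x‖ * ∑ a, M a := by
        gcongr with x
        exact hrow x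
    _ = (∑ x ∈ F, ‖u x‖) * ∑ a, M a := (Finset.sum_mul _ _ _).symm

theorem interp_rpow_eq {p q N a b : ℝ} (hpq : p.HolderConjugate q) (hq : 2 ≤ q) (hN : 0 ≤ N)
    (ha : 0 ≤ a) (hb : 0 ≤ b) :
    (a * b) ^ (1 - 2 / q) * (√(N * a) * √b) ^ (2 / q) =
      N ^ (1 / q) * a ^ (1 / p) * b ^ (1 / p) := by
  have hq₀ : 0 < q := by linarith
  have hsplit {x : ℝ} (hx : 0 ≤ x) : x ^ (1 - 2 / q) * x ^ (1 / q) = x ^ (1 / p) := by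
    rw [← Real.rpow_add_of_nonneg hx (sub_nonneg.2 ((div_le_one hq₀).2 hq)) (by positivity),
      one_div p, ← hpq.symm.one_sub_inv]
    ring_nf
  have hsqrt {x : ℝ} (hx : 0 ≤ x) : √x ^ (2 / q) = x ^ (1 / q) := by
    rw [Real.sqrt_eq_rpow, ← Real.rpow_mul hx]
    ring_nf
  rw [Real.mul_rpow ha hb, Real.mul_rpow (Real.sqrt_nonneg _) (Real.sqrt_nonneg _),
    hsqrt (mul_nonneg hN ha), hsqrt hb, Real.mul_rpow hN ha, ← hsplit ha, ← hsplit hb]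
  ring

/-- The analytic family through `s ^ p` at `re z = 0` and `s ^ (p / 2)` at `re z = 1`. -/
def rowFamily (p s : ℝ) (z : ℂ) : ℂ := (s : ℂ) ^ (p * (1 - z / 2))

/-- The analytic family through `τ ^ p` at `re z = 0` and `τ ^ ((p - q) / 2) * t ^ (q / 2)` at
`re z = 1`. -/
def columnFamily (p q τ t : ℝ) (z : ℂ) : ℂ :=
  (τ : ℂ) ^ (p * (1 - z / 2) - q * (z / 2)) * (t : ℂ) ^ (q * (z / 2))

theorem norm_rowFamily {s : ℝ} (hs : 0 < s) (p : ℝ) (z : ℂ) :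
    ‖rowFamily p s z‖ = s ^ (p * (1 - z.re / 2)) := by
  rw [rowFamily, Complex.norm_cpow_eq_rpow_re_of_pos hs]
  simp

theorem norm_columnFamily {τ t : ℝ} (hτ : 0 < τ) (ht : 0 < t) (p q : ℝ) (z : ℂ) :
    ‖columnFamily p q τ t z‖ =
      τ ^ (p * (1 - z.re / 2) - q * (z.re / 2)) * t ^ (q * (z.re / 2)) := by
  rw [columnFamily, norm_mul, Complex.norm_cpow_eq_rpow_re_of_pos hτ,
    Complex.norm_cpow_eq_rpow_re_of_pos ht]
  simp

theorem differentiable_rowFamily {s : ℝ} (hs : 0 < s) (p : ℝ) :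
    Differentiable ℂ (rowFamily p s) := by
  have hs' : (s : ℂ) ≠ 0 := Complex.ofReal_ne_zero.2 hs.ne'
  exact Differentiable.const_cpow (by fun_prop) (Or.inl hs')

theorem differentiable_columnFamily {τ t : ℝ} (hτ : 0 < τ) (ht : 0 < t) (p q : ℝ) :
    Differentiable ℂ (columnFamily p q τ t) := by
  have hτ' : (τ : ℂ) ≠ 0 := Complex.ofReal_ne_zero.2 hτ.ne'
  have ht' : (t : ℂ) ≠ 0 := Complex.ofReal_ne_zero.2 ht.ne'
  exact (Differentiable.const_cpow (by fun_prop) (Or.inl hτ')).mul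
    (Differentiable.const_cpow (by fun_prop) (Or.inl ht'))

theorem mul_one_sub_two_div_div_two {p q : ℝ} (hpq : p.HolderConjugate q) :
    (p : ℂ) * (1 - ((2 / q : ℝ) : ℂ) / 2) = 1 := by
  have hreal : p * (1 - 2 / q / 2) = 1 := by
    rw [div_right_comm, div_self two_ne_zero, one_div, hpq.symm.one_sub_inv,
      mul_inv_cancel₀ hpq.ne_zero]
  exact_mod_cast hreal

theorem rowFamily_two_div {p q : ℝ} (hpq : p.HolderConjugate q) (s : ℝ) :
    rowFamily p s (2 / q : ℝ) = s := by
  rw [rowFamily, mul_one_sub_two_div_div_two hpq, Complex.cpow_one]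

theorem columnFamily_two_div {p q : ℝ} (hpq : p.HolderConjugate q) (τ t : ℝ) :
    columnFamily p q τ t (2 / q : ℝ) = t := by
  have hq : (q : ℂ) * (((2 / q : ℝ) : ℂ) / 2) = 1 := by
    have hreal : q * (2 / q / 2) = 1 := by
      rw [div_right_comm, div_self two_ne_zero, mul_one_div_cancel hpq.symm.ne_zero]
    exact_mod_cast hreal
  rw [columnFamily, mul_one_sub_two_div_div_two hpq, hq, sub_self, Complex.cpow_zero, one_mul,
    Complex.cpow_one]

theorem sum_norm_columnFamily_sq_le {p q : ℝ} {τ : I → ℝ} {t : (Σ a, l a) → ℝ}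
    (hτ : ∀ a, 0 ≤ τ a) (hτ' : ∀ y : Σ a, l a, 0 < τ y.1) (ht : ∀ y, 0 < t y)
    (htτ : ∀ a (J : Finset (l a)), ∑ j ∈ J, t ⟨a, j⟩ ^ q ≤ τ a ^ q) {z : ℂ} (hz : z.re = 1) :
    ∑ y ∈ G, ‖columnFamily p q (τ y.1) (t y) z‖ ^ 2 ≤ ∑ a, τ a ^ p := by
  have hsq (y : Σ a, l a) :
      ‖columnFamily p q (τ y.1) (t y) z‖ ^ 2 = τ y.1 ^ (p - q) * t y ^ q := by
    rw [norm_columnFamily (hτ' y) (ht y), hz, mul_pow, ← Real.rpow_mul_natCast (hτ _),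
      ← Real.rpow_mul_natCast (ht y).le]
    congr 2 <;> (push_cast; ring)
  simp_rw [hsq]
  refine sum_sigma_le (fun a J => ?_) G
  rcases J.eq_empty_or_nonempty with rfl | ⟨j, -⟩
  · simpa using Real.rpow_nonneg (hτ a) p
  have hτa : 0 < τ a := hτ' ⟨a, j⟩
  calc ∑ j ∈ J, τ a ^ (p - q) * t ⟨a, j⟩ ^ q = τ a ^ (p - q) * ∑ j ∈ J, t ⟨a, j⟩ ^ q :=
        (Finset.mul_sum _ _ _).symm
    _ ≤ τ a ^ (p - q) * τ a ^ q := by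
        gcongr
        exact htτ a J
    _ = τ a ^ p := by rw [← Real.rpow_add hτa, sub_add_cancel]

theorem norm_bilinearSum_le_of_interpolation {p q N : ℝ} (hpq : p.HolderConjugate q) (hq : 2 ≤ q)
    (hN : 0 ≤ N) (h₁ : ∀ x a (J : Finset (l a)), ∑ j ∈ J, ‖c x ⟨a, j⟩‖ ≤ 1)
    (h₂ : ∀ u w, ‖bilinearSum c F G u w‖ ≤ √(N * ∑ x ∈ F, ‖u x‖ ^ 2) * √(∑ y ∈ G, ‖w y‖ ^ 2))
    {s : α → ℝ} (hs : ∀ x, 0 < s x) {t : (Σ a, l a) → ℝ} (ht : ∀ y, 0 < t y) {τ : I → ℝ}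
    (hτ : ∀ a, 0 ≤ τ a) (htτ : ∀ a (J : Finset (l a)), ∑ j ∈ J, t ⟨a, j⟩ ^ q ≤ τ a ^ q) :
    ‖bilinearSum c F G (fun x => (s x : ℂ)) fun y => (t y : ℂ)‖ ≤
      N ^ (1 / q) * (∑ x ∈ F, s x ^ p) ^ (1 / p) * (∑ a, τ a ^ p) ^ (1 / p) := by
  have hq₀ : 0 < q := hpq.symm.pos
  have hτ₀ (y : Σ a, l a) : 0 < τ y.1 := by
    have hle : t y ^ q ≤ τ y.1 ^ q := by simpa using htτ y.1 {y.2}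
    exact (ht y).trans_le ((Real.rpow_le_rpow_iff (ht y).le (hτ _) hq₀).1 hle)
  let U (z : ℂ) (x : α) : ℂ := rowFamily p (s x) z
  let W (z : ℂ) (y : Σ a, l a) : ℂ := columnFamily p q (τ y.1) (t y) z
  have hU (z : ℂ) (x : α) : ‖U z x‖ = s x ^ (p * (1 - z.re / 2)) := norm_rowFamily (hs x) p z
  have hW (z : ℂ) (y : Σ a, l a) : ‖W z y‖ =
      τ y.1 ^ (p * (1 - z.re / 2) - q * (z.re / 2)) * t y ^ (q * (z.re / 2)) :=
    norm_columnFamily (hτ₀ y) (ht y) p q z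
  have hzero (z : ℂ) (hz : z.re = 0) :
      ‖bilinearSum c F G (U z) (W z)‖ ≤ (∑ x ∈ F, s x ^ p) * ∑ a, τ a ^ p := by
    have hUz (x : α) : ‖U z x‖ = s x ^ p := by rw [hU, hz]; simp
    have hWz (y : Σ a, l a) : ‖W z y‖ = τ y.1 ^ p := by rw [hW, hz]; simp
    simpa only [hUz] using norm_bilinearSum_le_of_block h₁ (U z)
      (fun a => Real.rpow_nonneg (hτ a) p) fun y => (hWz y).le
  have hone (z : ℂ) (hz : z.re = 1) :
      ‖bilinearSum c F G (U z) (W z)‖ ≤ √(N * ∑ x ∈ F, s x ^ p) * √(∑ a, τ a ^ p) := by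
    have hUz (x : α) : ‖U z x‖ ^ 2 = s x ^ p := by
      rw [hU, hz, ← Real.rpow_mul_natCast (hs x).le]
      ring_nf
    refine (h₂ (U z) (W z)).trans ?_
    simp only [hUz]
    gcongr
    exact sum_norm_columnFamily_sq_le hτ hτ₀ ht htτ hz
  have key := norm_bilinearSum_le_interp (U := U) (W := W)
    (fun x => differentiable_rowFamily (hs x) p)
    (fun y => differentiable_columnFamily (hτ₀ y) (ht y) p q)
    (fun z x => by rw [hU, hU, Complex.ofReal_re]) (fun z y => by rw [hW, hW, Complex.ofReal_re])
    hzero hone (θ := 2 / q) (by positivity) ((div_le_one hq₀).2 hq)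
  simp only [U, W, rowFamily_two_div hpq, columnFamily_two_div hpq] at key
  refine key.trans_eq (interp_rpow_eq hpq hq hN ?_ ?_)
  · exact Finset.sum_nonneg fun x _ => Real.rpow_nonneg (hs x).le p
  · exact Finset.sum_nonneg fun a _ => Real.rpow_nonneg (hτ a) p

end Interpolation

section Orthogonality

variable {𝕜 E : Type*} [RCLike 𝕜] [NormedAddCommGroup E] [InnerProductSpace 𝕜 E]

theorem norm_sum_sq_of_pairwise_inner_eq_zero {ι : Type*} {v : ι → E}
    (hv : Pairwise fun i j => inner 𝕜 (v i) (v j) = 0) (F : Finset ι) :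
    ‖∑ i ∈ F, v i‖ ^ 2 = ∑ i ∈ F, ‖v i‖ ^ 2 := by
  classical
  simp_rw [← inner_self_eq_norm_sq (𝕜 := 𝕜), sum_inner, inner_sum, map_sum]
  refine Finset.sum_congr rfl fun i hi => Finset.sum_eq_single i (fun j _ hj => ?_) (absurd hi)
  rw [hv hj.symm, map_zero]

theorem norm_sum_smul_le_sqrt {ι : Type*} {v : ι → E}
    (hv : Pairwise fun i j => inner 𝕜 (v i) (v j) = 0) {N : ℝ} (hN : ∀ i, ‖v i‖ ^ 2 ≤ N)
    (F : Finset ι) (u : ι → 𝕜) : ‖∑ i ∈ F, u i • v i‖ ≤ √(N * ∑ i ∈ F, ‖u i‖ ^ 2) := by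
  have horth : Pairwise fun i j => inner 𝕜 (u i • v i) (u j • v j) = 0 := fun i j hij => by
    simp only [inner_smul_left, inner_smul_right, hv hij, mul_zero]
  refine Real.le_sqrt_of_sq_le ?_
  rw [norm_sum_sq_of_pairwise_inner_eq_zero horth, Finset.mul_sum]
  gcongr with i
  rw [norm_smul, mul_pow, mul_comm]
  gcongr
  exact hN i

end Orthogonality

theorem norm_bilinearSum_inner_le {E α β : Type*} [NormedAddCommGroup E] [InnerProductSpace ℂ E]
    {c : α → β → ℂ} {v : α → E} {d : β → E} (hc : ∀ x y, c x y = ⟪d y, v x⟫_ℂ)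
    (hv : Pairwise fun x x' => ⟪v x, v x'⟫_ℂ = 0) {N : ℝ} (hN : ∀ x, ‖v x‖ ^ 2 ≤ N)
    (hd : Orthonormal ℂ d) (F : Finset α) (G : Finset β) (u : α → ℂ) (w : β → ℂ) :
    ‖bilinearSum c F G u w‖ ≤ √(N * ∑ x ∈ F, ‖u x‖ ^ 2) * √(∑ y ∈ G, ‖w y‖ ^ 2) := by
  have hinner : bilinearSum c F G u w = ⟪∑ y ∈ G, star (w y) • d y, ∑ x ∈ F, u x • v x⟫_ℂ := by
    simp_rw [inner_sum, sum_inner, inner_smul_left, inner_smul_right, bilinearSum, hc,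
      starRingEnd_apply, star_star, mul_left_comm, mul_comm]
  have hw := norm_sum_smul_le_sqrt hd.2 (N := 1) (fun y => by simp [hd.1]) G fun y => star (w y)
  simp_rw [norm_star, one_mul] at hw
  rw [hinner, mul_comm]
  exact (norm_inner_le_norm _ _).trans
    (mul_le_mul hw (norm_sum_smul_le_sqrt hv hN F u) (norm_nonneg _) (Real.sqrt_nonneg _))

section TensorVector

variable {H : Type*} [NormedAddCommGroup H] [InnerProductSpace ℂ H] [CompleteSpace H]
  {I : Type*} [Fintype I]

/-- The complex conjugate of a vector of `H`, formed coordinatewise; it lives in `ℓ²` since `H` has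
no canonical conjugation. -/
def conjCoord (x : H) : lp (fun _ : basisIndex H => ℂ) 2 := star ((basis H).repr x)

theorem inner_conjCoord (x y : H) : ⟪conjCoord x, conjCoord y⟫_ℂ = ⟪y, x⟫_ℂ := by
  rw [← (basis H).repr.inner_map_map y x, lp.inner_eq_tsum, lp.inner_eq_tsum]
  simp [conjCoord, mul_comm]

/-- The tensor `r ⊗ x ⊗ ȳ`, with `x ⊗ ȳ` standing for the rank one operator `⟨y, ·⟩ x`.
Orthogonality of the first factors separates operators belonging to different blocks. -/
def tensorVec (r : EuclideanSpace ℂ I) (x y : H) :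
    EuclideanSpace ℂ I ⊗[ℂ] (H ⊗[ℂ] lp (fun _ : basisIndex H => ℂ) 2) :=
  r ⊗ₜ (x ⊗ₜ conjCoord y)

theorem inner_tensorVec (r r' : EuclideanSpace ℂ I) (x x' y y' : H) :
    ⟪tensorVec r x y, tensorVec r' x' y'⟫_ℂ = ⟪r, r'⟫_ℂ * (⟪x, x'⟫_ℂ * ⟪y', y⟫_ℂ) := by
  rw [tensorVec, tensorVec, TensorProduct.inner_tmul, TensorProduct.inner_tmul, inner_conjCoord]

theorem norm_tensorVec (r : EuclideanSpace ℂ I) (x y : H) :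
    ‖tensorVec r x y‖ = ‖r‖ * (‖x‖ * ‖y‖) := by
  have hconj : ‖conjCoord y‖ = ‖y‖ := by
    rw [conjCoord, norm_star, LinearIsometryEquiv.norm_map]
  rw [tensorVec, TensorProduct.norm_tmul, TensorProduct.norm_tmul, hconj]

theorem pairwise_inner_tensorVec_eq_zero {K : Type*} {κ : K → Type*} {r : K → EuclideanSpace ℂ I}
    (hr : Pairwise fun k k' => ⟪r k, r k'⟫_ℂ = 0) {f : (k : K) → κ k → H}
    (hf : ∀ k, Orthonormal ℂ (f k)) (e : (Σ k, κ k) → H) :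
    Pairwise fun x x' : Σ k, κ k =>
      ⟪tensorVec (r x.1) (f x.1 x.2) (e x), tensorVec (r x'.1) (f x'.1 x'.2) (e x')⟫_ℂ = 0 := by
  rintro ⟨k, i⟩ ⟨k', i'⟩ hne
  rw [inner_tensorVec]
  rcases eq_or_ne k k' with rfl | hk
  · rw [(hf k).2 fun h : i = i' => hne (by rw [h]), zero_mul, mul_zero]
  · rw [hr hk, zero_mul]

theorem orthonormal_tensorVec_single [DecidableEq I] {l : I → Type*} {g h : (a : I) → l a → H}
    (hg : ∀ a, Orthonormal ℂ (g a)) (hh : ∀ a j, ‖h a j‖ = 1) :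
    Orthonormal ℂ fun y : Σ a, l a =>
      tensorVec (EuclideanSpace.single y.1 (1 : ℂ)) (g y.1 y.2) (h y.1 y.2) :=
  ⟨fun y => by simp [norm_tensorVec, (hg y.1).1, hh],
    pairwise_inner_tensorVec_eq_zero (EuclideanSpace.orthonormal_single (𝕜 := ℂ)).2 hg
      fun y => h y.1 y.2⟩

end TensorVector

theorem hasSum_sigma_of_fintype {I E : Type*} [Fintype I] [AddCommMonoid E] [TopologicalSpace E]
    [ContinuousAdd E] {l : I → Type*} {φ : (Σ a, l a) → E} {m : I → E}
    (h : ∀ a, HasSum (fun j => φ ⟨a, j⟩) (m a)) : HasSum φ (∑ a, m a) := by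
  classical
  have hsum (a : I) : Tendsto (fun J => ∑ j ∈ J, φ ⟨a, j⟩) atTop (𝓝 (m a)) := h a
  have hpre (a : I) : Tendsto (fun G : Finset (Σ a, l a) =>
      ∑ j ∈ G.preimage (Sigma.mk a) sigma_mk_injective.injOn, φ ⟨a, j⟩) atTop (𝓝 (m a)) :=
    (hsum a).comp (tendsto_finset_preimage_atTop_atTop sigma_mk_injective)
  refine (tendsto_finsetSum Finset.univ fun a _ => hpre a).congr fun G => ?_
  rw [← Finset.sum_sigma _ _ φ, G.sigma_preimage_mk_of_subset (Finset.subset_univ _)]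

theorem SchmidtDecomposition.isNuclearRep_sum_mul {H : Type u} [NormedAddCommGroup H]
    [InnerProductSpace ℂ H] {K : Type*} [Fintype K] {A C : K → H →L[ℂ] H}
    (S : (k : K) → SchmidtDecomposition (A k))
    (h : Summable fun x : Σ k, (S k).ι => (S x.1).s x.2 * ‖C x.1 ((S x.1).f x.2)‖) :
    IsNuclearRep (∑ k, C k * A k) (fun x : Σ k, (S k).ι => (S x.1).v x.2)
      fun x => ((S x.1).s x.2 : ℂ) • C x.1 ((S x.1).f x.2) where
  summable := by
    simpa only [norm_v_mul_norm_smul] using h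
  hasSum x := by
    rw [sum_apply]
    refine hasSum_sigma_of_fintype fun k => ?_
    refine (((S k).hasSum x).mapL (C k)).congr_fun fun i => ?_
    rw [map_smul, smul_smul, mul_comm]

/-- The rows of the matrix `ε` are pairwise orthogonal with squared norm at most `N`, and its
entries are bounded by `1`. -/
structure HasOrthogonalRows {K I : Type*} [Fintype I] (ε : K → EuclideanSpace ℂ I) (N : ℝ) :
    Prop where
  inner_eq_zero : Pairwise fun k k' => ⟪ε k, ε k'⟫_ℂ = 0
  norm_sq_le : ∀ k, ‖ε k‖ ^ 2 ≤ N
  norm_apply_le_one : ∀ k a, ‖ε k a‖ ≤ 1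

section TensorCoefficients

variable {H : Type*} [NormedAddCommGroup H] [InnerProductSpace ℂ H]
  {K I : Type*} {κ : K → Type*} {l : I → Type*} {ε : K → EuclideanSpace ℂ I} {N : ℝ}
  {f : (k : K) → κ k → H} {e : (Σ k, κ k) → H} {g h : (a : I) → l a → H}

/-- The matrix `ε_{ka} ⟨g_{aj}, f_{ki}⟩ ⟨e_{ki}, h_{aj}⟩`, whose rows are indexed by the pairs
`(k, i)` and whose columns are indexed by the pairs `(a, j)`. -/
def tensorCoeff (ε : K → EuclideanSpace ℂ I) (f : (k : K) → κ k → H) (e : (Σ k, κ k) → H)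
    (g h : (a : I) → l a → H) (x : Σ k, κ k) (y : Σ a, l a) : ℂ :=
  ε x.1 y.1 * (⟪g y.1 y.2, f x.1 x.2⟫_ℂ * ⟪e x, h y.1 y.2⟫_ℂ)

theorem sum_norm_tensorCoeff_le_one (hε : ∀ k a, ‖ε k a‖ ≤ 1) (hf : ∀ k i, ‖f k i‖ = 1)
    (he : ∀ x, ‖e x‖ ≤ 1) (hg : ∀ a, Orthonormal ℂ (g a)) (hh : ∀ a, Orthonormal ℂ (h a))
    (x : Σ k, κ k) (a : I) (J : Finset (l a)) :
    ∑ j ∈ J, ‖tensorCoeff ε f e g h x ⟨a, j⟩‖ ≤ 1 := by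
  calc ∑ j ∈ J, ‖tensorCoeff ε f e g h x ⟨a, j⟩‖
      = ‖ε x.1 a‖ * ∑ j ∈ J, ‖⟪g a j, f x.1 x.2⟫_ℂ‖ * ‖⟪e x, h a j⟫_ℂ‖ := by
        simp_rw [tensorCoeff, norm_mul, Finset.mul_sum]
    _ ≤ 1 * (‖f x.1 x.2‖ * ‖e x‖) := by
        gcongr
        · exact hε x.1 a
        · exact sum_norm_inner_mul_le (hg a) (hh a) J _ _
    _ ≤ 1 := by rw [hf, one_mul, one_mul]; exact he x

theorem norm_bilinearSum_tensorCoeff_le [CompleteSpace H] [Fintype I]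
    (hε : HasOrthogonalRows ε N)
    (hf : ∀ k, Orthonormal ℂ (f k)) (he : ∀ x, ‖e x‖ ≤ 1) (hg : ∀ a, Orthonormal ℂ (g a))
    (hh : ∀ a j, ‖h a j‖ = 1) (F : Finset (Σ k, κ k)) (G : Finset (Σ a, l a))
    (u : (Σ k, κ k) → ℂ) (w : (Σ a, l a) → ℂ) :
    ‖bilinearSum (tensorCoeff ε f e g h) F G u w‖ ≤
      √(N * ∑ x ∈ F, ‖u x‖ ^ 2) * √(∑ y ∈ G, ‖w y‖ ^ 2) := by
  classical
  refine norm_bilinearSum_inner_le (v := fun x => tensorVec (ε x.1) (f x.1 x.2) (e x))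
    (fun x y => ?_) (pairwise_inner_tensorVec_eq_zero hε.inner_eq_zero hf e) (fun x => ?_)
    (orthonormal_tensorVec_single hg hh) F G u w
  · rw [tensorCoeff, inner_tensorVec, EuclideanSpace.inner_single_left, map_one, one_mul]
  · rw [norm_tensorVec, (hf x.1).1, one_mul, mul_pow]
    exact (mul_le_of_le_one_right (sq_nonneg _) (pow_le_one₀ (norm_nonneg _) (he x))).trans
      (hε.norm_sq_le x.1)

end TensorCoefficients

section Trace

variable {H : Type u} [NormedAddCommGroup H] [InnerProductSpace ℂ H]
  {K I : Type*} [Fintype I] {ε : K → EuclideanSpace ℂ I} {N p q : ℝ}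
  {A : K → H →L[ℂ] H} {Y : I → H →L[ℂ] H}

/-- The operator `∑ₐ ε_{ka} Yₐ` that multiplies `A_k`. -/
def rowCombination (ε : K → EuclideanSpace ℂ I) (Y : I → H →L[ℂ] H) (k : K) : H →L[ℂ] H :=
  ∑ a, ε k a • Y a

theorem hasSum_tensorCoeff_mul (S : (k : K) → SchmidtDecomposition (A k))
    (R : (a : I) → SchmidtDecomposition (Y a)) (e : (Σ k, (S k).ι) → H) (x : Σ k, (S k).ι) :
    HasSum (fun y : Σ a, (R a).ι =>
        tensorCoeff ε (fun k => (S k).f) e (fun a => (R a).v) (fun a => (R a).f) x y *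
          (((S x.1).s x.2 : ℂ) * ((R y.1).s y.2 : ℂ)))
      ((S x.1).s x.2 * ⟪e x, rowCombination ε Y x.1 ((S x.1).f x.2)⟫_ℂ) := by
  let φ (y : Σ a, (R a).ι) : ℂ := tensorCoeff ε (fun k => (S k).f) e (fun a => (R a).v)
    (fun a => (R a).f) x y * (((S x.1).s x.2 : ℂ) * ((R y.1).s y.2 : ℂ))
  have hblock (a : I) : HasSum (fun j => φ ⟨a, j⟩)
      ((S x.1).s x.2 * (ε x.1 a * ⟪e x, Y a ((S x.1).f x.2)⟫_ℂ)) := by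
    have hsum := ((((R a).hasSum ((S x.1).f x.2)).mapL (innerSL ℂ (e x))).mul_left
      (ε x.1 a)).mul_left ((S x.1).s x.2 : ℂ)
    refine hsum.congr_fun fun j => ?_
    simp only [φ, tensorCoeff, innerSL_apply_apply, inner_smul_right]
    ring
  have hinner : (S x.1).s x.2 * ⟪e x, rowCombination ε Y x.1 ((S x.1).f x.2)⟫_ℂ =
      ∑ a, (S x.1).s x.2 * (ε x.1 a * ⟪e x, Y a ((S x.1).f x.2)⟫_ℂ) := by
    simp [rowCombination, Finset.mul_sum]
  rw [hinner]
  exact hasSum_sigma_of_fintype hblock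

theorem sum_mul_sum_smul_eq [Fintype K] (ε : K → EuclideanSpace ℂ I) (A : K → H →L[ℂ] H)
    (Y : I → H →L[ℂ] H) :
    ∑ a, Y a * ∑ k, ε k a • A k = ∑ k, rowCombination ε Y k * A k := by
  simp_rw [rowCombination, Finset.mul_sum, Finset.sum_mul, mul_smul_comm, smul_mul_assoc]
  exact Finset.sum_comm

variable [CompleteSpace H] [Fintype K]

theorem norm_sum_inner_le (hpq : p.HolderConjugate q) (hq : 2 ≤ q) (hN : 0 ≤ N)
    (hε : HasOrthogonalRows ε N) (hA : ∀ k, Mem p (A k)) (hY : ∀ a, Mem q (Y a))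
    (S : (k : K) → SchmidtDecomposition (A k)) {e : (Σ k, (S k).ι) → H} (he : ∀ x, ‖e x‖ ≤ 1)
    (F : Finset (Σ k, (S k).ι)) :
    ‖∑ x ∈ F, (S x.1).s x.2 * ⟪e x, rowCombination ε Y x.1 ((S x.1).f x.2)⟫_ℂ‖ ≤
      N ^ (1 / q) * (∑ k, norm p (A k) ^ p) ^ (1 / p) * (∑ a, norm q (Y a) ^ p) ^ (1 / p) := by
  let R (a : I) : SchmidtDecomposition (Y a) := (SchmidtDecomposition.nonempty (hY a).1).some
  let c := tensorCoeff ε (fun k => (S k).f) e (fun a => (R a).v) fun a => (R a).f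
  have hlim : Tendsto (fun G => bilinearSum c F G (fun x => ((S x.1).s x.2 : ℂ))
      fun y => ((R y.1).s y.2 : ℂ)) atTop
      (𝓝 (∑ x ∈ F, (S x.1).s x.2 * ⟪e x, rowCombination ε Y x.1 ((S x.1).f x.2)⟫_ℂ)) :=
    tendsto_finsetSum F fun x _ => hasSum_tensorCoeff_mul S R e x
  have hsum : ∑ x ∈ F, (S x.1).s x.2 ^ p ≤ ∑ k, norm p (A k) ^ p :=
    sum_sigma_le (fun k J => (S k).sum_rpow_le hpq.pos (hA k) J) F
  refine le_of_tendsto hlim.norm (Eventually.of_forall fun G => ?_)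
  refine (norm_bilinearSum_le_of_interpolation hpq hq hN
    (sum_norm_tensorCoeff_le_one hε.norm_apply_le_one (fun k => (S k).f_orthonormal.1) he
      (fun a => (R a).v_orthonormal) fun a => (R a).f_orthonormal)
    (norm_bilinearSum_tensorCoeff_le hε (fun k => (S k).f_orthonormal) he
      (fun a => (R a).v_orthonormal) (fun a => (R a).f_orthonormal.1) F G)
    (fun x => (S x.1).s_pos x.2) (fun y => (R y.1).s_pos y.2)
    (fun a => Schatten.norm_nonneg q (Y a))
    fun a J => (R a).sum_rpow_le hpq.symm.pos (hY a) J).trans ?_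
  have hp : 0 < p := hpq.pos
  have hs : 0 ≤ ∑ x ∈ F, (S x.1).s x.2 ^ p :=
    Finset.sum_nonneg fun x _ => Real.rpow_nonneg ((S x.1).s_pos x.2).le p
  have hY₀ : 0 ≤ ∑ a, norm q (Y a) ^ p :=
    Finset.sum_nonneg fun a _ => Real.rpow_nonneg (Schatten.norm_nonneg q (Y a)) p
  gcongr

theorem sum_mul_norm_rowCombination_le (hpq : p.HolderConjugate q) (hq : 2 ≤ q) (hN : 0 ≤ N)
    (hε : HasOrthogonalRows ε N) (hA : ∀ k, Mem p (A k)) (hY : ∀ a, Mem q (Y a))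
    (S : (k : K) → SchmidtDecomposition (A k)) (F : Finset (Σ k, (S k).ι)) :
    ∑ x ∈ F, (S x.1).s x.2 * ‖rowCombination ε Y x.1 ((S x.1).f x.2)‖ ≤
      N ^ (1 / q) * (∑ k, norm p (A k) ^ p) ^ (1 / p) * (∑ a, norm q (Y a) ^ p) ^ (1 / p) := by
  let b (x : Σ k, (S k).ι) : H := rowCombination ε Y x.1 ((S x.1).f x.2)
  let e (x : Σ k, (S k).ι) : H := ((‖b x‖⁻¹ : ℝ) : ℂ) • b x
  have he (x) : ‖e x‖ ≤ 1 := by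
    simpa [e, norm_smul] using inv_mul_le_one
  have hinner (x) : ⟪e x, b x⟫_ℂ = ‖b x‖ := by
    rw [inner_smul_left, inner_self_eq_norm_sq_to_K, Complex.conj_ofReal, Complex.ofReal_inv, sq,
      ← mul_assoc]
    exact inv_mul_mul_self _
  have hnonneg (x : Σ k, (S k).ι) : 0 ≤ (S x.1).s x.2 * ‖b x‖ :=
    mul_nonneg ((S x.1).s_pos x.2).le (norm_nonneg _)
  have key := norm_sum_inner_le hpq hq hN hε hA hY S he F
  simp_rw [b] at hinner hnonneg
  simp_rw [hinner, ← Complex.ofReal_mul, ← Complex.ofReal_sum, Complex.norm_real] at key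
  rwa [Real.norm_of_nonneg (Finset.sum_nonneg fun x _ => hnonneg x)] at key

theorem mem_one_and_norm_trace_sum_mul_le (hpq : p.HolderConjugate q) (hq : 2 ≤ q)
    (hN : 0 ≤ N) (hε : HasOrthogonalRows ε N) (hA : ∀ k, Mem p (A k)) (hY : ∀ a, Mem q (Y a)) :
    Mem 1 (∑ a, Y a * ∑ k, ε k a • A k) ∧ ‖trace (∑ a, Y a * ∑ k, ε k a • A k)‖ ≤
      N ^ (1 / q) * (∑ k, norm p (A k) ^ p) ^ (1 / p) * (∑ a, norm q (Y a) ^ p) ^ (1 / p) := by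
  have S (k : K) : SchmidtDecomposition (A k) := (SchmidtDecomposition.nonempty (hA k).1).some
  have hbound := sum_mul_norm_rowCombination_le hpq hq hN hε hA hY S
  have hsummable : Summable fun x : Σ k, (S k).ι =>
      (S x.1).s x.2 * ‖rowCombination ε Y x.1 ((S x.1).f x.2)‖ :=
    summable_of_sum_le (fun x => mul_nonneg ((S x.1).s_pos x.2).le (norm_nonneg _)) hbound
  have hrep := SchmidtDecomposition.isNuclearRep_sum_mul S hsummable
  rw [sum_mul_sum_smul_eq]
  refine ⟨hrep.mem_one, hrep.norm_trace_le.trans ?_⟩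
  simp_rw [SchmidtDecomposition.norm_v_mul_norm_smul]
  exact hsummable.tsum_le_of_sum_le hbound

end Trace

section Clarkson

variable {ι : Type*} [Fintype ι] [LinearOrder ι]

theorem sum_sum_one_sub_one_mul {R : Type*} [CommRing R] (k l : ι) :
    ∑ i, ∑ j, ((1 : Matrix ι ι R) k i - (1 : Matrix ι ι R) k j) *
        ((1 : Matrix ι ι R) l i - (1 : Matrix ι ι R) l j) =
      2 * (Fintype.card ι * (1 : Matrix ι ι R) k l - 1) := by
  have hone (m : ι) : ∑ i, (1 : Matrix ι ι R) m i = 1 := by simp [Matrix.one_apply]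
  have hmul : ∑ i, (1 : Matrix ι ι R) k i * (1 : Matrix ι ι R) l i = (1 : Matrix ι ι R) k l := by
    simp [Matrix.one_apply]
  simp only [sub_mul, mul_sub, Finset.sum_sub_distrib, Finset.sum_const, Finset.card_univ,
    nsmul_eq_mul]
  simp only [← Finset.mul_sum, ← Finset.sum_mul, hone, hmul]
  ring

variable [LocallyFiniteOrderTop ι]

theorem sum_option_sigma_Ioi {M : Type*} [AddCommMonoid M] (x : M) (ψ : ι → ι → M) :
    ∑ a : Option (Σ i : ι, Finset.Ioi i), a.elim x (fun y => ψ y.1 y.2) =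
      x + ∑ i, ∑ j ∈ Finset.Ioi i, ψ i j := by
  rw [Fintype.sum_option, Fintype.sum_sigma]
  congr 1
  exact Finset.sum_congr rfl fun i _ => Finset.sum_coe_sort _ (ψ i)

/-- The coefficients of the operators `A_k` in `∑ A_k` (column `none`) and in the differences
`Aᵢ - Aⱼ`, `i < j`. -/
def clarksonCoeff (k : ι) : EuclideanSpace ℂ (Option (Σ i : ι, Finset.Ioi i)) :=
  WithLp.toLp 2 fun a =>
    a.elim 1 fun y => (1 : Matrix ι ι ℂ) k y.1 - (1 : Matrix ι ι ℂ) k y.2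

theorem two_mul_sum_sum_Ioi {R : Type*} [CommRing R] {ψ : ι → ι → R} (hψ : ∀ i j, ψ i j = ψ j i)
    (h₀ : ∀ i, ψ i i = 0) : 2 * ∑ i, ∑ j ∈ Finset.Ioi i, ψ i j = ∑ i, ∑ j, ψ i j := by
  let _ : LocallyFiniteOrderBot ι :=
    LocallyFiniteOrderBot.ofIic' ι (fun b => {a | a ≤ b}) (by simp)
  calc 2 * ∑ i, ∑ j ∈ Finset.Ioi i, ψ i j = ∑ i, ∑ j ∈ Finset.Ioi i, (ψ j i + ψ i j) := by
        simp_rw [hψ _ _, ← two_mul, Finset.mul_sum]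
    _ = ∑ i, ∑ j ∈ {i}ᶜ, ψ j i := Finset.sum_sum_Ioi_add_eq_sum_sum_off_diag ψ
    _ = ∑ i, ∑ j, ψ i j := by
        refine Finset.sum_congr rfl fun i _ => ?_
        simp_rw [hψ _ i, Fintype.sum_eq_add_sum_compl i, h₀, zero_add]

theorem inner_clarksonCoeff (k l : ι) :
    ⟪clarksonCoeff k, clarksonCoeff l⟫_ℂ = Fintype.card ι * (1 : Matrix ι ι ℂ) k l := by
  let ψ (i j : ι) : ℂ := ((1 : Matrix ι ι ℂ) k i - (1 : Matrix ι ι ℂ) k j) *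
    ((1 : Matrix ι ι ℂ) l i - (1 : Matrix ι ι ℂ) l j)
  have hψ : 2 * ∑ i, ∑ j ∈ Finset.Ioi i, ψ i j =
      2 * (Fintype.card ι * (1 : Matrix ι ι ℂ) k l - 1) :=
    (two_mul_sum_sum_Ioi (fun i j => by ring) fun i => by simp [ψ]).trans
      (sum_sum_one_sub_one_mul k l)
  have hinner : ⟪clarksonCoeff k, clarksonCoeff l⟫_ℂ = 1 + ∑ i, ∑ j ∈ Finset.Ioi i, ψ i j := by
    rw [← sum_option_sigma_Ioi, PiLp.inner_apply]
    refine Finset.sum_congr rfl fun a _ => ?_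
    rcases a with _ | y
    · simp [clarksonCoeff]
    · simp only [clarksonCoeff, ψ, Matrix.one_apply, Option.elim_some, RCLike.inner_apply]
      split_ifs <;> simp
  linear_combination hinner + hψ / 2

theorem hasOrthogonalRows_clarksonCoeff :
    HasOrthogonalRows (clarksonCoeff (ι := ι)) (Fintype.card ι) where
  inner_eq_zero k l hkl := by simp [inner_clarksonCoeff, hkl]
  norm_sq_le k := by
    rw [← inner_self_eq_norm_sq (𝕜 := ℂ), inner_clarksonCoeff]
    simp
  norm_apply_le_one k a := by
    rcases a with _ | ⟨i, j⟩
    · simp [clarksonCoeff]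
    · simp only [clarksonCoeff, Option.elim_some, Matrix.one_apply]
      split_ifs <;> simp

theorem sum_clarksonCoeff_smul {E : Type*} [AddCommGroup E] [Module ℂ E] (A : ι → E)
    (a : Option (Σ i : ι, Finset.Ioi i)) :
    ∑ k, clarksonCoeff k a • A k = a.elim (∑ k, A k) fun y => A y.1 - A y.2 := by
  rcases a with _ | ⟨i, j⟩ <;>
    simp [clarksonCoeff, sub_smul, Finset.sum_sub_distrib, Matrix.one_apply]

end Clarkson

end Schatten

end

theorem lemma2p2_general {H ι : Type*} [NormedAddCommGroup H] [InnerProductSpace ℂ H]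
    [CompleteSpace H] [Fintype ι] [LinearOrder ι] [LocallyFiniteOrderTop ι]
    (p q : ℝ) (hp1 : 1 < p) (hp2 : p ≤ 2) (hpq : 1 / p + 1 / q = 1)
    (A : ι → H →L[ℂ] H) (hA : ∀ k, Schatten.Mem p (A k))
    (Y : H →L[ℂ] H) (hY : Schatten.Mem q Y)
    (Y' : ι → ι → H →L[ℂ] H) (hY' : ∀ i j, i < j → Schatten.Mem q (Y' i j)) :
    Schatten.Mem 1 (Y * ∑ k, A k + ∑ i, ∑ j ∈ Finset.Ioi i, Y' i j * (A i - A j)) ∧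
    ‖Schatten.trace (Y * ∑ k, A k + ∑ i, ∑ j ∈ Finset.Ioi i, Y' i j * (A i - A j))‖ ≤
      (Fintype.card ι : ℝ) ^ (1 / q) * (∑ k, Schatten.norm p (A k) ^ p) ^ (1 / p) *
        (Schatten.norm q Y ^ p + ∑ i, ∑ j ∈ Finset.Ioi i, Schatten.norm q (Y' i j) ^ p) ^
          (1 / p) := by
  have hconj : p.HolderConjugate q :=
    Real.holderConjugate_iff.2 ⟨hp1, by simpa only [one_div] using hpq⟩
  have hq : 2 ≤ q := by
    have hp : 1 / 2 ≤ 1 / p := one_div_le_one_div_of_le hconj.pos hp2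
    exact (one_div_le_one_div hconj.symm.pos two_pos).1 (by linarith)
  let Z (a : Option (Σ i : ι, Finset.Ioi i)) : H →L[ℂ] H := a.elim Y fun y => Y' y.1 y.2
  have hZ : ∀ a, Schatten.Mem q (Z a)
    | none => hY
    | some ⟨i, j⟩ => hY' i j (Finset.mem_Ioi.1 j.2)
  have hT : Y * ∑ k, A k + ∑ i, ∑ j ∈ Finset.Ioi i, Y' i j * (A i - A j) =
      ∑ a, Z a * ∑ k, Schatten.clarksonCoeff k a • A k := by
    rw [← Schatten.sum_option_sigma_Ioi _ fun i j => Y' i j * (A i - A j)]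
    refine Finset.sum_congr rfl fun a _ => ?_
    rw [Schatten.sum_clarksonCoeff_smul]
    cases a <;> rfl
  have hnorm : Schatten.norm q Y ^ p + ∑ i, ∑ j ∈ Finset.Ioi i, Schatten.norm q (Y' i j) ^ p =
      ∑ a, Schatten.norm q (Z a) ^ p := by
    rw [← Schatten.sum_option_sigma_Ioi _ fun i j => Schatten.norm q (Y' i j) ^ p]
    refine Finset.sum_congr rfl fun a _ => ?_
    cases a <;> rfl
  rw [hT, hnorm]
  exact Schatten.mem_one_and_norm_trace_sum_mul_le hconj hq (Nat.cast_nonneg _)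
    Schatten.hasOrthogonalRows_clarksonCoeff hA hZ

theorem lemma2p2 {H : Type*} [NormedAddCommGroup H] [InnerProductSpace ℂ H] [CompleteSpace H]
    [TopologicalSpace.SeparableSpace H]
    (p q : ℝ) (hp1 : 1 < p) (hp2 : p ≤ 2) (hpq : 1 / p + 1 / q = 1)
    (n : ℕ) (A : Fin n → H →L[ℂ] H) (hA : ∀ k, Schatten.Mem p (A k))
    (Y : H →L[ℂ] H) (hY : Schatten.Mem q Y)
    (Y' : Fin n → Fin n → H →L[ℂ] H) (hY' : ∀ i j, i < j → Schatten.Mem q (Y' i j)) :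
    Schatten.Mem 1 (Y * ∑ k, A k + ∑ i, ∑ j ∈ Finset.Ioi i, Y' i j * (A i - A j)) ∧
    ‖Schatten.trace (Y * ∑ k, A k + ∑ i, ∑ j ∈ Finset.Ioi i, Y' i j * (A i - A j))‖ ≤
      (n : ℝ) ^ (1 / q) * (∑ k, Schatten.norm p (A k) ^ p) ^ (1 / p) *
        (Schatten.norm q Y ^ p + ∑ i, ∑ j ∈ Finset.Ioi i, Schatten.norm q (Y' i j) ^ p) ^
          (1 / p) := by
  simpa only [Fintype.card_fin] using lemma2p2_general p q hp1 hp2 hpq A hA Y hY Y' hY'
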